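/- Let $(X,\mathcal{A},\mu)$ be a $\sigma$-finite measure space with $\mu(X)=\infty$ and $\mu$ continuous ($\mu\{x\}=0$ for all $x\in X$), and let $T:X\to X$ be an invertible, bi-measurable, $\mu$-preserving transformation. Let $X^*$ be the space of counting measures $\nu=\sum_{i\in I}\delta_{x_i}$ ($I$ countable, $x_i\in X$), with the $\sigma$-algebra $\mathcal{A}^*$ generated by the maps $N(A):\nu\mapsto\nu(A)$, $A\in\mathcal{A}$. For a $\sigma$-finite measure $\lambda$ on $X$ with $\lambda(X)=\infty$, let $\lambda^*$ be the probability measure on $X^*$ under which, for pairwise disjoint $A_1,\dots,A_k\in\mathcal{A}$ of finite measure, $N(A_1),\dots,N(A_k)$ are independent Poisson variables with parameters $\lambda(A_1),\dots,\lambda(A_k)$. Let $T_*\nu=\nu\circ T^{-1}$; the system $(X^*,\mathcal{A}^*,\lambda^*,T_*)$ is the Poisson suspension with intensity $\lambda$ (for $\lambda$ invariant under $T$). Let $\mathcal{A}^*\odot\mathcal{A}^*$ be the $\sigma$-algebra of the sets in $\mathcal{A}^*\otimes\mathcal{A}^*$ that are invariant under $(\nu_1,\nu_2)\mapsto(\nu_2,\nu_1)$,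 and let $T_*\odot T_*$ denote the system $(X^*\times X^*,\ \mathcal{A}^*\odot\mathcal{A}^*,\ \mu^*\otimes\mu^*,\ T_*\times T_*)$. A factor of a system $(Y,\mathcal{B},P,S)$ with $P$ a probability measure is a sub-$\sigma$-algebra $\mathcal{C}\subset\mathcal{B}$ with $S^{-1}\mathcal{C}=\mathcal{C}$; the system is prime if every factor is equal, modulo $P$-null sets, to $\mathcal{B}$ or to $\{Y,\emptyset\}$. Then $T_*\odot T_*$ is never prime. More precisely, the map $\Psi(\nu_1,\nu_2)=\nu_1+\nu_2$ is a factor map from $T_*\odot T_*$ onto the Poisson suspension $(X^*,\mathcal{A}^*,(2\mu)^*,T_*)$, that is, $\Psi$ is measurable for $\mathcal{A}^*\odot\mathcal{A}^*$, maps $\mu^*\otimes\mu^*$ to $(2\mu)^*$ and satisfies $\Psi\circ(T_*\times T_*)=T_*\circ\Psi$; and $\Psi^{-1}\mathcal{A}^*$ is a factor of $T_*\odot T_*$ which, modulo null sets, is neither $\mathcal{A}^*\odot\mathcal{A}^*$ nor trivial. -/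

import Mathlib

open MeasureTheory ProbabilityTheory
open scoped ENNReal NNReal

namespace PoissonSuspension

/-- `ν` is a counting measure: a sum of Dirac masses over a countable family of points of `X`
(repetitions and infinite families are allowed). -/
def IsCounting {X : Type*} [MeasurableSpace X] (ν : Measure X) : Prop :=
  ∃ (I : Type) (_ : Countable I) (x : I → X), ν = Measure.sum fun i => Measure.dirac (x i)

/-- The space `X*` of counting measures on `X`. As a subtype of `Measure X` it carries the
σ-algebra generated by the maps `ν ↦ ν A`, for `A` measurable. -/
abbrev Config (X : Type*) [MeasurableSpace X] : Type _ := {ν : Measure X // IsCounting ν}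

/-- The map `N(A)` on `X*`, which counts the points falling into `A`. -/
def count {X : Type*} [MeasurableSpace X] (A : Set X) (ν : Config X) : ℝ≥0∞ := ν.1 A

theorem measurable_count {X : Type*} [MeasurableSpace X] {A : Set X} (hA : MeasurableSet A) :
    Measurable (count A) :=
  (Measure.measurable_coe hA).comp measurable_subtype_coe

theorem isCounting_map {X Y : Type*} [MeasurableSpace X] [MeasurableSpace Y] {φ : X → Y}
    (hφ : Measurable φ) {ν : Measure X} (hν : IsCounting ν) : IsCounting (ν.map φ) := by
  obtain ⟨I, hI, x, rfl⟩ := hν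
  refine ⟨I, hI, fun i => φ (x i), ?_⟩
  rw [Measure.map_sum hφ.aemeasurable]
  simp [Measure.map_dirac' hφ]

theorem isCounting_sum {X : Type*} {J : Type} [MeasurableSpace X] [Countable J]
    {ν : J → Measure X} (hν : ∀ j, IsCounting (ν j)) : IsCounting (Measure.sum ν) := by
  choose I hI x hx using hν
  refine ⟨Σ j, I j, inferInstance, fun k => x k.1 k.2, ?_⟩
  ext s hs
  simp only [Measure.sum_apply _ hs, hx]
  exact (ENNReal.tsum_sigma fun i j => Measure.dirac (x i j) s).symm

theorem isCounting_add {X : Type*} [MeasurableSpace X] {ν₁ ν₂ : Measure X}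
    (h₁ : IsCounting ν₁) (h₂ : IsCounting ν₂) : IsCounting (ν₁ + ν₂) := by
  rw [← Measure.sum_cond]
  exact isCounting_sum fun b => by cases b <;> simpa

/-- `P` is the law of a Poisson measure with intensity `μ`: a probability measure on `X*` under
which `N(A)` has the Poisson distribution with parameter `μ A` whenever `μ A < ∞` (the Dirac mass
at `0` if `μ A = 0`), and `N(A₁), …, N(A_k)` are independent for pairwise disjoint measurable sets
of finite measure. -/
structure IsPoissonLaw {X : Type*} [MeasurableSpace X] (μ : Measure X)
    (P : Measure (Config X)) : Prop where
  isProbabilityMeasure : IsProbabilityMeasure P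
  law : ∀ A : Set X, MeasurableSet A → μ A < ∞ →
    P.map (count A) = (poissonMeasure (μ A).toNNReal).map (fun n : ℕ => (n : ℝ≥0∞))
  indep : ∀ (k : ℕ) (A : Fin k → Set X), (∀ i, MeasurableSet (A i)) →
    Pairwise (Function.onFun Disjoint A) → (∀ i, μ (A i) < ∞) →
    iIndepFun (fun i => count (A i)) P

/-- Auxiliary description of a Poisson law through its mean and its characteristic functions, used
only to prove that Poisson laws exist. -/
structure PoissonCF {X : Type*} [MeasurableSpace X] (μ : Measure X)
    (P : Measure (Config X)) : Prop where
  isProbabilityMeasure : IsProbabilityMeasure P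
  mean : ∀ A : Set X, MeasurableSet A → ∫⁻ ν, count A ν ∂P = μ A
  cf : ∀ (k : ℕ) (A : Fin k → Set X) (t : Fin k → ℝ), (∀ i, MeasurableSet (A i)) →
    Pairwise (Function.onFun Disjoint A) → (∀ i, μ (A i) < ∞) →
    charFun (P.map fun ν => ∑ i, t i * (count (A i) ν).toReal) 1 =
      Complex.exp (∑ i, (μ.real (A i) : ℂ) * (Complex.exp (t i * Complex.I) - 1))

theorem measurable_lin {X : Type*} [MeasurableSpace X] {k : ℕ} {A : Fin k → Set X} (t : Fin k → ℝ)
    (hA : ∀ i, MeasurableSet (A i)) :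
    Measurable (fun ν : Config X => ∑ i, t i * (count (A i) ν).toReal) :=
  Finset.measurable_sum _ fun i _ => ((measurable_count (hA i)).ennreal_toReal).const_mul _

theorem PoissonCF.isPoissonLaw {X : Type*} [MeasurableSpace X] {μ : Measure X}
    {P : Measure (Config X)} (h : PoissonCF μ P) : IsPoissonLaw μ P := by
  have := h.isProbabilityMeasure
  have hfin : ∀ A : Set X, MeasurableSet A → μ A < ∞ →
      (fun ν => ENNReal.ofReal (count A ν).toReal) =ᵐ[P] count A := by
    intro A hA hμ
    have h1 : ∀ᵐ ν ∂P, count A ν < ∞ :=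
      ae_lt_top (measurable_count hA) (by rw [h.mean A hA]; exact hμ.ne)
    filter_upwards [h1] with ν hν using ENNReal.ofReal_toReal hν.ne
  have hcf1 : ∀ A : Set X, MeasurableSet A → μ A < ∞ → ∀ t : ℝ,
      charFun (P.map fun ν => (count A ν).toReal) t =
        Complex.exp ((μ.real A : ℂ) * (Complex.exp (t * Complex.I) - 1)) := by
    intro A hA hμ t
    have := h.cf 1 (fun _ => A) (fun _ => t) (fun _ => hA)
      (fun i j hij => absurd (Subsingleton.elim i j) hij) (fun _ => hμ)
    simp only [Finset.univ_unique, Finset.sum_singleton] at this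
    rw [← this, charFun_apply_real, charFun_apply_real,
      integral_map (measurable_count hA).ennreal_toReal.aemeasurable (by fun_prop),
      integral_map ((measurable_count hA).ennreal_toReal.const_mul _).aemeasurable (by fun_prop)]
    simp
  refine ⟨this, fun A hA hμ => ?_, fun k A hA hd hμ => ?_⟩
  · have hreal : P.map (fun ν => (count A ν).toReal) =
        (poissonMeasure (μ A).toNNReal).map (Nat.cast : ℕ → ℝ) := by
      have : IsProbabilityMeasure (P.map fun ν => (count A ν).toReal) :=
        Measure.isProbabilityMeasure_map (measurable_count hA).ennreal_toReal.aemeasurable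
      apply Measure.ext_of_charFun
      ext t
      rw [hcf1 A hA hμ, charFun_map_cast_poissonMeasure]
      rfl
    rw [← Measure.map_congr (hfin A hA hμ)]
    have := congrArg (Measure.map ENNReal.ofReal) hreal
    rw [Measure.map_map ENNReal.measurable_ofReal (measurable_count hA).ennreal_toReal,
      Measure.map_map ENNReal.measurable_ofReal .of_discrete] at this
    refine this.trans ?_
    congr 1
    ext n
    simp
  · have hreal : iIndepFun (fun i ν => (count (A i) ν).toReal) P := by
      rw [iIndepFun_iff_charFun_pi
        fun i => (measurable_count (hA i)).ennreal_toReal.aemeasurable]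
      intro t
      have h2 := h.cf k A (fun i => t i) hA hd (fun i => (hμ i))
      rw [Finset.prod_congr rfl fun i _ => hcf1 (A i) (hA i) (hμ i) (t i), ← Complex.exp_sum,
        ← h2, charFun_apply_real, charFun_apply,
        integral_map (measurable_lin (fun i => t i) hA).aemeasurable (by fun_prop),
        integral_map ?_ (by fun_prop)]
      · simp [PiLp.inner_apply, mul_comm]
      · refine Measurable.aemeasurable ?_
        have := fun i => (measurable_count (hA i)).ennreal_toReal
        fun_prop
    exact (hreal.comp (fun _ => ENNReal.ofReal) fun _ => ENNReal.measurable_ofReal).congr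
      fun i => hfin (A i) (hA i) (hμ i)

theorem lintegral_natCast_poissonMeasure (r : ℝ≥0) :
    ∫⁻ n, (n : ℝ≥0∞) ∂poissonMeasure r = r := by
  rw [poissonMeasure, lintegral_sum_measure]
  simp only [lintegral_smul_measure, lintegral_dirac, smul_eq_mul]
  rw [tsum_eq_zero_add' ENNReal.summable]
  have hs : HasSum (fun n : ℕ => Real.exp (-r) * (r : ℝ) ^ n / (n.factorial)) 1 :=
    hasSum_one_poissonMeasure r
  have : ∀ n : ℕ, ENNReal.ofReal (Real.exp (-r) * (r : ℝ) ^ (n + 1) / ((n + 1).factorial)) *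
      ((n + 1 : ℕ) : ℝ≥0∞) = r * ENNReal.ofReal (Real.exp (-r) * (r : ℝ) ^ n / (n.factorial)) := by
    intro n
    rw [← ENNReal.ofReal_natCast (n + 1), ← ENNReal.ofReal_coe_nnreal (p := r),
      ← ENNReal.ofReal_mul (by positivity), ← ENNReal.ofReal_mul (by positivity)]
    congr 1
    rw [Nat.factorial_succ]
    push_cast
    field_simp
    ring
  simp only [this]
  rw [ENNReal.tsum_mul_left, ← ENNReal.ofReal_tsum_of_nonneg (fun n => by positivity) hs.summable,
    hs.tsum_eq]
  simp

theorem exists_poissonCF_of_isFiniteMeasure {X : Type*} [MeasurableSpace X] (μ : Measure X)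
    [IsFiniteMeasure μ] : ∃ P, PoissonCF μ P := by
  rcases eq_or_ne μ 0 with rfl | h0
  · let ν₀ : Config X := ⟨0, Empty, inferInstance, Empty.elim, by simp⟩
    refine ⟨Measure.dirac ν₀, inferInstance, fun A hA => ?_, fun k A t hA hd hμ => ?_⟩
    · rw [lintegral_dirac' _ (measurable_count hA)]
      simp [count, ν₀]
    · rw [Measure.map_dirac' (measurable_lin t hA)]
      simp [charFun_dirac, count, ν₀]
  have : NeZero μ := ⟨h0⟩
  let r : ℝ≥0 := (μ Set.univ).toNNReal
  have hr : (r : ℝ≥0∞) = μ Set.univ := ENNReal.coe_toNNReal (measure_ne_top _ _)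
  let ρ : Measure X := (μ Set.univ)⁻¹ • μ
  have hρ : IsProbabilityMeasure ρ := isProbabilityMeasureSMul
  have hrρ : ∀ A, (r : ℝ≥0∞) * ρ A = μ A := by
    intro A
    rw [hr, Measure.smul_apply, smul_eq_mul, ← mul_assoc,
      ENNReal.mul_inv_cancel (by simpa using h0) (measure_ne_top _ _), one_mul]
  let Q : Measure (ℕ × (ℕ → X)) := (poissonMeasure r).prod (Measure.infinitePi fun _ => ρ)
  let Φ : ℕ × (ℕ → X) → Config X := fun p =>
    ⟨Measure.sum fun j : Fin p.1 => Measure.dirac (p.2 j), Fin p.1, inferInstance, _, rfl⟩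
  have hcount : ∀ A, MeasurableSet A → ∀ p, count A (Φ p) =
      ∑ j ∈ Finset.range p.1, A.indicator 1 (p.2 j) := by
    intro A hA p
    simp only [count, Φ, Measure.sum_apply _ hA, Measure.dirac_apply' _ hA, tsum_fintype]
    rw [Finset.sum_range]
  have hΦ : Measurable Φ := by
    refine Measurable.subtype_mk (Measure.measurable_of_measurable_coe _ fun A hA => ?_)
    have : (fun p : ℕ × (ℕ → X) => (Φ p).1 A) =
      fun p => ∑ j ∈ Finset.range p.1, A.indicator 1 (p.2 j) := funext (hcount A hA)
    change Measurable (fun p : ℕ × (ℕ → X) => (Φ p).1 A)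
    rw [this]
    have hj : ∀ j : ℕ, Measurable fun x : ℕ → X => A.indicator (1 : X → ℝ≥0∞) (x j) :=
      fun j => (measurable_one.indicator hA).comp (measurable_pi_apply j)
    exact measurable_from_prod_countable_right fun n =>
      Finset.measurable_sum (Finset.range n) fun j _ => hj j
  refine ⟨Q.map Φ, Measure.isProbabilityMeasure_map hΦ.aemeasurable, fun A hA => ?_,
    fun k A t hA hd hμ => ?_⟩
  · rw [lintegral_map (measurable_count hA) hΦ,
      lintegral_prod (fun p => count A (Φ p)) ((measurable_count hA).comp hΦ).aemeasurable]
    have : ∀ n : ℕ, ∫⁻ x, count A (Φ (n, x)) ∂(Measure.infinitePi fun _ : ℕ => ρ) = n * ρ A := by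
      intro n
      have h0 : ∀ j : ℕ, Measurable fun x : ℕ → X => A.indicator (1 : X → ℝ≥0∞) (x j) :=
        fun j => (measurable_one.indicator hA).comp (measurable_pi_apply j)
      have h1 : ∀ j : ℕ, ∫⁻ x : ℕ → X, A.indicator (1 : X → ℝ≥0∞) (x j)
          ∂(Measure.infinitePi fun _ => ρ) = ρ A := fun j =>
        ((measurePreserving_eval_infinitePi (fun _ : ℕ => ρ) j).lintegral_comp
          (f := A.indicator (1 : X → ℝ≥0∞)) (measurable_one.indicator hA)).trans
          (lintegral_indicator_one hA)
      simp only [hcount A hA]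
      rw [lintegral_finsetSum _ fun j _ => h0 j]
      simp [h1]
    simp only [this]
    rw [lintegral_mul_const _ .of_discrete, lintegral_natCast_poissonMeasure, hrρ]
  · let f : X → ℝ := fun x => ∑ i, t i * (A i).indicator 1 x
    have hf : Measurable f := Finset.measurable_sum _ fun i _ =>
      (measurable_one.indicator (hA i)).const_mul _
    have hlin : ∀ p, ∑ i, t i * (count (A i) (Φ p)).toReal = ∑ j ∈ Finset.range p.1, f (p.2 j) := by
      intro p
      simp only [f]
      rw [Finset.sum_comm]
      refine Finset.sum_congr rfl fun i _ => ?_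
      rw [hcount _ (hA i), ENNReal.toReal_sum, Finset.mul_sum]
      · refine Finset.sum_congr rfl fun j _ => ?_
        by_cases hx : p.2 j ∈ A i <;> simp [hx]
      · intro j _
        by_cases hx : p.2 j ∈ A i <;> simp [hx]
    let c : ℂ := ∫ x, Complex.exp (f x * Complex.I) ∂ρ
    have hfib : ∀ n : ℕ, ∫ x, Complex.exp ((∑ j ∈ Finset.range n, f (x j) : ℝ) * Complex.I)
        ∂(Measure.infinitePi fun _ : ℕ => ρ) = c ^ n := by
      intro n
      have hind : iIndepFun (fun (i : ℕ) (x : ℕ → X) => f (x i)) (Measure.infinitePi fun _ => ρ) :=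
        iIndepFun_infinitePi (P := fun _ : ℕ => ρ) (X := fun _ => f) fun _ => hf
      have hm : ∀ j : ℕ, Measurable fun x : ℕ → X => f (x j) :=
        fun j => hf.comp (measurable_pi_apply j)
      have h1 := congrFun ((hind.restrict (Finset.range n)).charFun_map_fun_finsetSum_eq_prod
        (X := fun (i : ℕ) (x : ℕ → X) => f (x i)) (fun i _ => (hm i).aemeasurable)) 1
      rw [charFun_apply_real,
        integral_map (Finset.measurable_sum _ fun j _ => hm j).aemeasurable (by fun_prop),
        Finset.prod_apply] at h1
      simp only [Complex.ofReal_one, one_mul] at h1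
      rw [h1, Finset.prod_eq_pow_card (b := c), Finset.card_range]
      intro j _
      rw [charFun_apply_real, integral_map (hm j).aemeasurable (by fun_prop)]
      simp only [Complex.ofReal_one, one_mul]
      have h2 := (measurePreserving_eval_infinitePi (fun _ : ℕ => ρ) j).map_eq
      have h3 : Measurable fun x => Complex.exp (f x * Complex.I) := by fun_prop
      have h4 := integral_map (μ := Measure.infinitePi fun _ : ℕ => ρ)
        (measurable_pi_apply j).aemeasurable
        (h3.aestronglyMeasurable (μ := (Measure.infinitePi fun _ : ℕ => ρ).map (Function.eval j)))
      rw [h2] at h4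
      exact h4.symm
    have hc : (r : ℂ) * (c - 1) =
        ∑ i, (μ.real (A i) : ℂ) * (Complex.exp (t i * Complex.I) - 1) := by
      have hpt : ∀ x, Complex.exp (f x * Complex.I) =
          1 + ∑ i, (A i).indicator (fun _ => Complex.exp (t i * Complex.I) - 1) x := by
        intro x
        by_cases hx : ∃ i, x ∈ A i
        · obtain ⟨i, hi⟩ := hx
          have hne : ∀ j, j ≠ i → x ∉ A j := fun j hj hxj =>
            Set.disjoint_left.1 (hd hj) hxj hi
          simp only [f]
          rw [Finset.sum_eq_single i (fun j _ hj => by simp [hne j hj]) (by simp),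
            Finset.sum_eq_single i (fun j _ hj => by simp [hne j hj]) (by simp)]
          simp [hi]
        · push Not at hx
          simp [f, hx]
      have hint : ∀ i, Integrable
          ((A i).indicator (fun _ => Complex.exp (t i * Complex.I) - 1)) ρ :=
        fun i => (integrable_const _).indicator (hA i)
      have hreal : ∀ i, (μ.real (A i) : ℂ) = r * (ρ.real (A i) : ℂ) := by
        intro i
        simp only [Measure.real, ← hrρ (A i), ENNReal.toReal_mul]
        simp
      change (r : ℂ) * ((∫ x, Complex.exp (f x * Complex.I) ∂ρ) - 1) = _
      simp only [hpt]
      rw [integral_add (integrable_const _) (integrable_finsetSum _ fun i _ => hint i),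
        integral_finsetSum _ fun i _ => hint i]
      simp only [integral_indicator (hA _), integral_const, measureReal_restrict_apply_univ,
        hreal]
      simp [Finset.mul_sum, mul_assoc]
    have hmeas : Measurable fun p : ℕ × (ℕ → X) => ∑ j ∈ Finset.range p.1, f (p.2 j) := by
      simp only [← hlin]
      exact (measurable_lin t hA).comp hΦ
    rw [charFun_apply_real, integral_map (measurable_lin t hA).aemeasurable (by fun_prop),
      integral_map hΦ.aemeasurable
        (by have := measurable_lin t hA
            exact (by fun_prop : Measurable _).aestronglyMeasurable)]
    simp only [Complex.ofReal_one, one_mul, hlin]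
    rw [integral_prod]
    · simp only [hfib]
      rw [integral_poissonMeasure, ← hc]
      have h3 := (NormedSpace.expSeries_div_hasSum_exp ((r : ℂ) * c)).mul_left
        (Complex.exp (-(r : ℂ)))
      rw [← Complex.exp_eq_exp_ℂ, ← Complex.exp_add] at h3
      rw [show (r : ℂ) * (c - 1) = -(r : ℂ) + r * c by ring, ← h3.tsum_eq]
      refine tsum_congr fun n => ?_
      simp only [Complex.real_smul]
      push_cast
      ring
    · refine Integrable.of_bound (C := 1)
        (by fun_prop : Measurable _).aestronglyMeasurable (ae_of_all _ fun p => ?_)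
      rw [Complex.norm_exp_ofReal_mul_I]

/-- Poisson measures exist. -/
theorem exists_isPoissonLaw {X : Type*} [MeasurableSpace X] (μ : Measure X) [SFinite μ] :
    ∃ P, IsPoissonLaw μ P := by
  have hsum : Measure.sum (sfiniteSeq μ) = μ := sum_sfiniteSeq μ
  choose P hP using fun m => exists_poissonCF_of_isFiniteMeasure (sfiniteSeq μ m)
  have hprob := fun m => (hP m).isProbabilityMeasure
  let Φ : (ℕ → Config X) → Config X := fun ω =>
    ⟨Measure.sum fun m => (ω m).1, isCounting_sum fun m => (ω m).2⟩
  have hcount : ∀ A, MeasurableSet A → ∀ ω, count A (Φ ω) = ∑' m, count A (ω m) :=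
    fun A hA ω => Measure.sum_apply _ hA
  have hmc : ∀ A, MeasurableSet A → ∀ m : ℕ, Measurable fun ω : ℕ → Config X => count A (ω m) :=
    fun A hA m => (measurable_count hA).comp (measurable_pi_apply m)
  have hΦ : Measurable Φ := by
    refine Measurable.subtype_mk (Measure.measurable_of_measurable_coe _ fun A hA => ?_)
    change Measurable fun ω => count A (Φ ω)
    simp only [hcount A hA]
    exact Measurable.tsum (hmc A hA)
  have hev := measurePreserving_eval_infinitePi P
  have hmean : ∀ A, MeasurableSet A →
      ∫⁻ ω, ∑' m, count A (ω m) ∂(Measure.infinitePi P) = μ A := by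
    intro A hA
    rw [lintegral_tsum fun m => (hmc A hA m).aemeasurable]
    have h1 : μ A = ∑' m, sfiniteSeq μ m A :=
      (congrArg (fun m : Measure X => m A) hsum.symm).trans (Measure.sum_apply _ hA)
    rw [h1]
    refine tsum_congr fun m => ?_
    exact ((hev m).lintegral_comp (measurable_count hA)).trans ((hP m).mean A hA)
  refine ⟨(Measure.infinitePi P).map Φ, PoissonCF.isPoissonLaw ⟨?_, fun A hA => ?_,
    fun k A t hA hd hμ => ?_⟩⟩
  · exact Measure.isProbabilityMeasure_map hΦ.aemeasurable
  · rw [lintegral_map (measurable_count hA) hΦ]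
    simp only [hcount A hA, hmean A hA]
  · let Z : Config X → ℝ := fun ν => ∑ i, t i * (count (A i) ν).toReal
    have hZ : Measurable Z := measurable_lin t hA
    have hZm : ∀ m : ℕ, Measurable fun ω : ℕ → Config X => Z (ω m) :=
      fun m => hZ.comp (measurable_pi_apply m)
    have hle : ∀ m, sfiniteSeq μ m ≤ μ := fun m =>
      (Measure.le_sum (sfiniteSeq μ) m).trans hsum.le
    let e : ℕ → ℂ := fun m =>
      ∑ i, ((sfiniteSeq μ m).real (A i) : ℂ) * (Complex.exp (t i * Complex.I) - 1)
    have hpart : ∀ M : ℕ, ∫ ω, Complex.exp ((∑ m ∈ Finset.range M, Z (ω m) : ℝ) * Complex.I)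
        ∂(Measure.infinitePi P) = Complex.exp (∑ m ∈ Finset.range M, e m) := by
      intro M
      have hind : iIndepFun (fun (m : ℕ) (ω : ℕ → Config X) => Z (ω m)) (Measure.infinitePi P) :=
        iIndepFun_infinitePi (P := P) (X := fun _ => Z) fun _ => hZ
      have h1 := congrFun ((hind.restrict (Finset.range M)).charFun_map_fun_finsetSum_eq_prod
        (X := fun (m : ℕ) (ω : ℕ → Config X) => Z (ω m)) (fun i _ => (hZm i).aemeasurable)) 1
      rw [charFun_apply_real,
        integral_map (Finset.measurable_sum _ fun j _ => hZm j).aemeasurable (by fun_prop),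
        Finset.prod_apply] at h1
      simp only [Complex.ofReal_one, one_mul] at h1
      rw [h1, Complex.exp_sum]
      refine Finset.prod_congr rfl fun m _ => ?_
      have h2 := (hP m).cf k A t hA hd fun i => (hle m (A i)).trans_lt (hμ i)
      refine Eq.trans ?_ h2
      congr 1
      rw [← (hev m).map_eq, Measure.map_map hZ (measurable_pi_apply m)]
      rfl
    have hfin : ∀ᵐ ω ∂(Measure.infinitePi P), ∀ i, ∑' m, count (A i) (ω m) ≠ ∞ := by
      rw [ae_all_iff]
      intro i
      have := ae_lt_top (Measurable.tsum (hmc (A i) (hA i)))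
        (by rw [hmean (A i) (hA i)]; exact (hμ i).ne)
      filter_upwards [this] with ω hω using hω.ne
    have hlim : ∀ᵐ ω ∂(Measure.infinitePi P),
        HasSum (fun m => Z (ω m)) (Z (Φ ω)) := by
      filter_upwards [hfin] with ω hω
      refine hasSum_sum fun i _ => HasSum.mul_left _ ?_
      rw [hcount _ (hA i), ENNReal.tsum_toReal_eq (fun m => ENNReal.ne_top_of_tsum_ne_top (hω i) m)]
      exact (ENNReal.summable_toReal (hω i)).hasSum
    have hL : Filter.Tendsto (fun M : ℕ => Complex.exp (∑ m ∈ Finset.range M, e m)) Filter.atTop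
        (nhds (Complex.exp
          (∑ i, (μ.real (A i) : ℂ) * (Complex.exp (t i * Complex.I) - 1)))) := by
      refine (Complex.continuous_exp.tendsto _).comp (HasSum.tendsto_sum_nat ?_)
      refine hasSum_sum fun i _ => HasSum.mul_right _ ?_
      rw [Complex.hasSum_ofReal]
      have h5 : μ (A i) = ∑' m, sfiniteSeq μ m (A i) :=
        (congrArg (fun m : Measure X => m (A i)) hsum.symm).trans (Measure.sum_apply _ (hA i))
      have h6 : ∑' m, sfiniteSeq μ m (A i) ≠ ∞ := h5 ▸ (hμ i).ne
      rw [Measure.real, h5,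
        ENNReal.tsum_toReal_eq (fun m => ENNReal.ne_top_of_tsum_ne_top h6 m)]
      exact (ENNReal.summable_toReal h6).hasSum
    have hR : Filter.Tendsto (fun M : ℕ =>
        ∫ ω, Complex.exp ((∑ m ∈ Finset.range M, Z (ω m) : ℝ) * Complex.I)
          ∂(Measure.infinitePi P)) Filter.atTop
        (nhds (∫ ω, Complex.exp ((Z (Φ ω) : ℝ) * Complex.I) ∂(Measure.infinitePi P))) := by
      refine tendsto_integral_of_dominated_convergence (fun _ => 1) (fun M => ?_)
        (integrable_const _) (fun M => ae_of_all _ fun ω => ?_) ?_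
      · have : Measurable fun ω : ℕ → Config X => ∑ m ∈ Finset.range M, Z (ω m) :=
          Finset.measurable_sum _ fun j _ => hZm j
        exact (by fun_prop : Measurable _).aestronglyMeasurable
      · rw [Complex.norm_exp_ofReal_mul_I]
      · filter_upwards [hlim] with ω hω
        have hcont : Continuous fun z : ℝ => Complex.exp (z * Complex.I) := by fun_prop
        exact (hcont.tendsto _).comp hω.tendsto_sum_nat
    rw [charFun_apply_real, integral_map hZ.aemeasurable (by fun_prop),
      integral_map hΦ.aemeasurable (by fun_prop : Measurable _).aestronglyMeasurable]
    simp only [Complex.ofReal_one, one_mul]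
    simp only [hpart] at hR
    exact tendsto_nhds_unique hR hL

/-- The law `μ*` on `X*` of the Poisson measure with intensity `μ`. (It is the only measure with the
property `IsPoissonLaw μ`.) -/
noncomputable def poissonLaw {X : Type*} [MeasurableSpace X] (μ : Measure X) [SigmaFinite μ] :
    Measure (Config X) :=
  (exists_isPoissonLaw μ).choose

theorem isPoissonLaw_poissonLaw {X : Type*} [MeasurableSpace X] (μ : Measure X) [SigmaFinite μ] :
    IsPoissonLaw μ (poissonLaw μ) :=
  (exists_isPoissonLaw μ).choose_spec

instance {X : Type*} [MeasurableSpace X] (μ : Measure X) [SigmaFinite μ] :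
    IsProbabilityMeasure (poissonLaw μ) :=
  (isPoissonLaw_poissonLaw μ).isProbabilityMeasure

/-- The transformation `T_* : ν ↦ ν ∘ T⁻¹` of `X*`. -/
noncomputable def suspend {X : Type*} [MeasurableSpace X] (T : X ≃ᵐ X) (ν : Config X) : Config X :=
  ⟨ν.1.map T, isCounting_map T.measurable ν.2⟩

/-- The superposition map `(ν₁, ν₂) ↦ ν₁ + ν₂`. -/
noncomputable def superpose {X : Type*} [MeasurableSpace X] (p : Config X × Config X) : Config X :=
  ⟨p.1.1 + p.2.1, isCounting_add p.1.2 p.2.2⟩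

/-- The symmetric σ-algebra on `X* × X*`: the sets of the product σ-algebra that are invariant
under the exchange of the coordinates; equivalently, the σ-algebra generated by the measurable
symmetric functions. -/
@[reducible] def symmAlgebra (X : Type*) [MeasurableSpace X] : MeasurableSpace (Config X × Config X) :=
  MeasurableSpace.invariants (Prod.swap : Config X × Config X → Config X × Config X)

/-- The restriction of `μ* ⊗ μ*` to the symmetric σ-algebra. -/
noncomputable def symmLaw {X : Type*} [MeasurableSpace X] (μ : Measure X) [SigmaFinite μ] :
    @Measure (Config X × Config X) (symmAlgebra X) :=
  ((poissonLaw μ).prod (poissonLaw μ)).trim (MeasurableSpace.invariants_le _)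

/-- A factor of the system `(Y, 𝒜, P, S)`: a sub-σ-algebra `C` of `𝒜` with `S⁻¹ C = C`. -/
def IsFactor {Y : Type*} (𝒜 : MeasurableSpace Y) (S : Y → Y) (C : MeasurableSpace Y) : Prop :=
  C ≤ 𝒜 ∧ MeasurableSpace.comap S C = C

/-- The sub-σ-algebra `C` is the whole σ-algebra `𝒜` modulo null sets. -/
def IsFull {Y : Type*} (C 𝒜 : MeasurableSpace Y) (P : @Measure Y 𝒜) : Prop :=
  ∀ A : Set Y, MeasurableSet[𝒜] A → ∃ B : Set Y, MeasurableSet[C] B ∧ A =ᵐ[P] B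

/-- The sub-σ-algebra `C` of `𝒜` is `{Y, ∅}` modulo null sets. -/
def IsTrivial {Y : Type*} (C 𝒜 : MeasurableSpace Y) (P : @Measure Y 𝒜) : Prop :=
  ∀ B : Set Y, MeasurableSet[C] B → P B = 0 ∨ P Bᶜ = 0

/-- The system `(Y, 𝒜, P, S)` is prime: modulo null sets, `𝒜` and `{Y, ∅}` are its only
factors. -/
def IsPrime {Y : Type*} (𝒜 : MeasurableSpace Y) (P : @Measure Y 𝒜) (S : Y → Y) : Prop :=
  ∀ C : MeasurableSpace Y, IsFactor 𝒜 S C → IsFull C 𝒜 P ∨ IsTrivial C 𝒜 P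

/-- `φ` is a factor map from the system `(Y, 𝒜, P, S)` onto the system `(Z, ℬ, Q, R)`. -/
def IsFactorMap {Y Z : Type*} (𝒜 : MeasurableSpace Y) (P : @Measure Y 𝒜) (S : Y → Y)
    (ℬ : MeasurableSpace Z) (Q : @Measure Z ℬ) (R : Z → Z) (φ : Y → Z) : Prop :=
  MeasurePreserving φ P Q ∧ φ ∘ S = R ∘ φ

/-- The transformation `T_* × T_*` of `X* × X*` (and `T_* ⊙ T_*`, when `X* × X*` carries the
symmetric σ-algebra). -/
noncomputable def suspendProd {X : Type*} [MeasurableSpace X] (T : X ≃ᵐ X) :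
    Config X × Config X → Config X × Config X :=
  Prod.map (suspend T) (suspend T)

/-- The sub-σ-algebra of `X* × X*` generated by the superposition map. -/
@[reducible] noncomputable def superposeAlgebra (X : Type*) [MeasurableSpace X] :
    MeasurableSpace (Config X × Config X) :=
  MeasurableSpace.comap superpose (inferInstance : MeasurableSpace (Config X))

end PoissonSuspension

open PoissonSuspension

/-!
Poisson laws are determined by their intensity, so the superposition of independent Poisson
configurations of intensities `μ₁` and `μ₂` has the Poisson law of intensity `μ₁ + μ₂`; hence
`Ψ(ν₁, ν₂) = ν₁ + ν₂` sends `μ* ⊗ μ*` to `(2μ)*`. If `0 < μ A < ∞`, the event that `ν₁ + ν₂` has no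
point in `A` has a probability strictly between `0` and `1`, so `Ψ⁻¹𝒜*` is not trivial. To see that
it is a strict factor, write each of `ν₁` and `ν₂` as the superposition of two independent Poisson
configurations of intensity `μ / 2`, and exchange a half of `ν₁` with a half of `ν₂`. This preserves
the law and the sum, hence every set of `Ψ⁻¹𝒜*`, but it moves the symmetric event that `ν₁` or `ν₂`
has no point in `A`: if both halves of `ν₁` charge `A` and those of `ν₂` do not, then both
configurations charge `A` after the exchange.
-/

namespace PoissonSuspension

variable {X : Type*} [MeasurableSpace X]

theorem IsPoissonLaw.iIndepFun_count {ι : Type*} [Finite ι] {μ : Measure X}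
    {P : Measure (Config X)} (h : IsPoissonLaw μ P) {A : ι → Set X}
    (hA : ∀ i, MeasurableSet (A i)) (hd : Pairwise (Function.onFun Disjoint A))
    (hμ : ∀ i, μ (A i) < ∞) : iIndepFun (fun i => count (A i)) P := by
  have e := Finite.equivFin ι
  have hfin := h.indep _ (A ∘ e.symm) (fun _ => hA _)
    (fun i j hij => hd (e.symm.injective.ne hij)) fun _ => hμ _
  simpa only [Function.comp_apply, e.symm_apply_apply] using hfin.precomp e.injective

theorem IsPoissonLaw.map_counts_of_disjoint {ι : Type*} [Fintype ι] {μ : Measure X}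
    {P : Measure (Config X)} (h : IsPoissonLaw μ P) {A : ι → Set X}
    (hA : ∀ i, MeasurableSet (A i)) (hd : Pairwise (Function.onFun Disjoint A))
    (hμ : ∀ i, μ (A i) < ∞) :
    P.map (fun ν i => count (A i) ν) =
      Measure.pi fun i => (poissonMeasure (μ (A i)).toNNReal).map fun n : ℕ => (n : ℝ≥0∞) := by
  rw [(h.iIndepFun_count hA hd hμ).map_fun_eq_pi_map
    fun i => (measurable_count (hA i)).aemeasurable]
  simp only [h.law _ (hA _) (hμ _)]

/-- The cell `{x | J = {i | x ∈ A i}}`, with `J` nonempty, of the partition of `⋃ i, A i` generated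
by the sets `A i`. Cells reduce counts in overlapping sets to counts in disjoint ones. The cell of
`J = ∅` is empty rather than the complement of `⋃ i, A i`, so that all the cells have finite measure
as soon as all the `A i` do. -/
def cell {α ι : Type*} (A : ι → Set α) (J : Set ι) : Set α :=
  {x ∈ ⋃ i, A i | ∀ i, x ∈ A i ↔ i ∈ J}

theorem measurableSet_cell {ι : Type*} [Countable ι] {A : ι → Set X}
    (hA : ∀ i, MeasurableSet (A i)) (J : Set ι) : MeasurableSet (cell A J) :=
  (MeasurableSet.iUnion hA).inter <|
    Measurable.setOf <| Measurable.forall fun i => (hA i).mem.iff measurable_const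

theorem pairwise_disjoint_cell {α ι : Type*} (A : ι → Set α) :
    Pairwise (Function.onFun Disjoint (cell A)) := fun _ _ hJK =>
  Set.disjoint_left.2 fun _ hJ hK => hJK <| Set.ext fun i => (hJ.2 i).symm.trans (hK.2 i)

theorem iUnion_cell_eq {α ι : Type*} (A : ι → Set α) (i : ι) :
    ⋃ J : {J : Set ι // i ∈ J}, cell A J = A i := by
  ext x
  simp only [Set.mem_iUnion]
  constructor
  · rintro ⟨⟨J, hi⟩, -, hx⟩
    exact (hx i).2 hi
  · exact fun hx => ⟨⟨{j | x ∈ A j}, hx⟩, Set.mem_iUnion_of_mem i hx, fun _ => Iff.rfl⟩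

theorem count_eq_tsum_cell {ι : Type*} [Finite ι] {A : ι → Set X}
    (hA : ∀ i, MeasurableSet (A i)) (i : ι) (ν : Config X) :
    count (A i) ν = ∑' J : {J : Set ι // i ∈ J}, count (cell A J) ν := by
  unfold count
  rw [← measure_iUnion ((pairwise_disjoint_cell A).comp_of_injective Subtype.val_injective)
    fun J => measurableSet_cell hA J.1, iUnion_cell_eq]

theorem IsPoissonLaw.map_counts_eq {ι : Type*} [Finite ι] {μ : Measure X}
    {P Q : Measure (Config X)} (hP : IsPoissonLaw μ P) (hQ : IsPoissonLaw μ Q) {A : ι → Set X}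
    (hA : ∀ i, MeasurableSet (A i)) (hμ : ∀ i, μ (A i) < ∞) :
    P.map (fun ν i => count (A i) ν) = Q.map (fun ν i => count (A i) ν) := by
  have := Fintype.ofFinite ι
  have hcell := measurableSet_cell hA
  have hcell_lt (J : Set ι) : μ (cell A J) < ∞ :=
    (measure_mono (Set.sep_subset _ _)).trans_lt <|
      (measure_iUnion_fintype_le μ A).trans_lt <| ENNReal.sum_lt_top.2 fun i _ => hμ i
  let cellCounts : Config X → Set ι → ℝ≥0∞ := fun ν J => count (cell A J) ν
  have hcellCounts : Measurable cellCounts :=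
    measurable_pi_lambda _ fun J => measurable_count (hcell J)
  let total : (Set ι → ℝ≥0∞) → ι → ℝ≥0∞ := fun c i => ∑' J : {J : Set ι // i ∈ J}, c J
  have htotal : Measurable total :=
    measurable_pi_lambda _ fun i => Measurable.tsum fun J => measurable_pi_apply J.1
  have hcounts : (fun ν i => count (A i) ν) = total ∘ cellCounts :=
    funext fun ν => funext fun i => count_eq_tsum_cell hA i ν
  rw [hcounts, ← Measure.map_map htotal hcellCounts, ← Measure.map_map htotal hcellCounts,
    hP.map_counts_of_disjoint hcell (pairwise_disjoint_cell A) hcell_lt,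
    hQ.map_counts_of_disjoint hcell (pairwise_disjoint_cell A) hcell_lt]

theorem count_eq_iSup_inter_spanningSets (μ : Measure X) [SigmaFinite μ] (A : Set X)
    (ν : Config X) : count A ν = ⨆ n, count (A ∩ spanningSets μ n) ν := by
  have hmono : Monotone fun n => A ∩ spanningSets μ n := fun _ _ hmn =>
    Set.inter_subset_inter_right A (monotone_spanningSets μ hmn)
  unfold count
  rw [← hmono.measure_iUnion, ← Set.inter_iUnion, iUnion_spanningSets, Set.inter_univ]

/-- The family of the counts of a configuration in the measurable sets of finite measure, the only
ones whose joint laws `IsPoissonLaw` prescribes. -/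
def finiteCounts (μ : Measure X) (ν : Config X) (A : {A : Set X // MeasurableSet A ∧ μ A < ∞}) :
    ℝ≥0∞ :=
  count A.1 ν

theorem measurable_finiteCounts (μ : Measure X) : Measurable (finiteCounts μ) :=
  measurable_pi_lambda _ fun A => measurable_count A.2.1

theorem le_comap_finiteCounts (μ : Measure X) [SigmaFinite μ] :
    (inferInstance : MeasurableSpace (Config X)) ≤
      MeasurableSpace.comap (finiteCounts μ) inferInstance := by
  have hcount (A : Set X) (hA : MeasurableSet A) :
      Measurable[MeasurableSpace.comap (finiteCounts μ) inferInstance] (count A) := by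
    have hn (n : ℕ) : MeasurableSet (A ∩ spanningSets μ n) ∧ μ (A ∩ spanningSets μ n) < ∞ :=
      ⟨hA.inter (measurableSet_spanningSets μ n),
        measure_inter_lt_top_of_right_ne_top (measure_spanningSets_lt_top μ n).ne⟩
    have hsup : Measurable fun c : {A : Set X // MeasurableSet A ∧ μ A < ∞} → ℝ≥0∞ =>
        ⨆ n, c ⟨_, hn n⟩ := Measurable.iSup fun n => measurable_pi_apply _
    rw [funext (count_eq_iSup_inter_spanningSets μ A)]
    exact hsup.comp (comap_measurable (finiteCounts μ))
  exact (@Measure.measurable_of_measurable_coe _ _ _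
    (MeasurableSpace.comap (finiteCounts μ) inferInstance) Subtype.val hcount).comap_le

theorem IsPoissonLaw.unique {μ : Measure X} [SigmaFinite μ] {P Q : Measure (Config X)}
    (hP : IsPoissonLaw μ P) (hQ : IsPoissonLaw μ Q) : P = Q := by
  have := hP.isProbabilityMeasure
  have := hQ.isProbabilityMeasure
  have hΦ := measurable_finiteCounts μ
  have hproj (I : Finset {A : Set X // MeasurableSet A ∧ μ A < ∞}) :
      (P.map (finiteCounts μ)).map I.restrict = (Q.map (finiteCounts μ)).map I.restrict := by
    rw [Measure.map_map (Finset.measurable_restrict I) hΦ,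
      Measure.map_map (Finset.measurable_restrict I) hΦ]
    exact hP.map_counts_eq hQ (fun A : I => A.1.2.1) fun A => A.1.2.2
  have hmap : P.map (finiteCounts μ) = Q.map (finiteCounts μ) :=
    IsProjectiveLimit.unique (P := fun I => (Q.map (finiteCounts μ)).map I.restrict)
      hproj fun _ => rfl
  ext s hs
  obtain ⟨u, hu, rfl⟩ := le_comap_finiteCounts μ s hs
  rw [← Measure.map_apply hΦ hu, ← Measure.map_apply hΦ hu, hmap]

theorem iIndepFun_prodMk_prod {ι Ω Ω' α β : Type*} [Finite ι] [MeasurableSpace Ω]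
    [MeasurableSpace Ω'] [MeasurableSpace α] [MeasurableSpace β] {P : Measure Ω} {Q : Measure Ω'}
    {f : ι → Ω → α} {g : ι → Ω' → β} (hf : ∀ i, Measurable (f i)) (hg : ∀ i, Measurable (g i))
    (hfP : iIndepFun f P) (hgQ : iIndepFun g Q) :
    iIndepFun (fun i p => (f i p.1, g i p.2)) (P.prod Q) := by
  have := Fintype.ofFinite ι
  have := hfP.isProbabilityMeasure
  have := hgQ.isProbabilityMeasure
  have hfpi : Measurable fun ω i => f i ω := measurable_pi_lambda _ hf
  have hgpi : Measurable fun ω i => g i ω := measurable_pi_lambda _ hg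
  have hfg (i : ι) : Measurable fun p : Ω × Ω' => (f i p.1, g i p.2) := (hf i).prodMap (hg i)
  have hjoint : (P.prod Q).map (fun p => ((fun i => f i p.1), fun i => g i p.2)) =
      (Measure.pi fun i => P.map (f i)).prod (Measure.pi fun i => Q.map (g i)) := by
    rw [← hfP.map_fun_eq_pi_map fun i => (hf i).aemeasurable,
      ← hgQ.map_fun_eq_pi_map fun i => (hg i).aemeasurable, Measure.map_prod_map _ _ hfpi hgpi]
    rfl
  have (i : ι) := Measure.isProbabilityMeasure_map (μ := P) (hf i).aemeasurable
  have (i : ι) := Measure.isProbabilityMeasure_map (μ := Q) (hg i).aemeasurable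
  have hpair := (measurePreserving_arrowProdEquivProdArrow α β ι
    (fun i => P.map (f i)) fun i => Q.map (g i)).symm
  rw [iIndepFun_iff_map_fun_eq_pi_map fun i => (hfg i).aemeasurable]
  calc (P.prod Q).map (fun p i => (f i p.1, g i p.2))
    _ = ((P.prod Q).map fun p => ((fun i => f i p.1), fun i => g i p.2)).map
          (MeasurableEquiv.arrowProdEquivProdArrow α β ι).symm :=
        (Measure.map_map hpair.measurable (hfpi.prodMap hgpi)).symm
    _ = Measure.pi fun i => (P.map (f i)).prod (Q.map (g i)) := by rw [hjoint, hpair.map_eq]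
    _ = Measure.pi fun i => (P.prod Q).map fun p => (f i p.1, g i p.2) := by
        simp only [Measure.map_prod_map _ _ (hf _) (hg _)]
        rfl

theorem iIndepFun_map {ι Ω Ω' : Type*} {β : ι → Type*} [MeasurableSpace Ω] [MeasurableSpace Ω']
    [∀ i, MeasurableSpace (β i)] {P : Measure Ω} {φ : Ω → Ω'} {f : ∀ i, Ω' → β i}
    (hφ : Measurable φ) (hf : ∀ i, Measurable (f i)) (h : iIndepFun (fun i => f i ∘ φ) P) :
    iIndepFun f (P.map φ) := by
  have := h.isProbabilityMeasure
  have := Measure.isProbabilityMeasure_map (μ := P) hφ.aemeasurable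
  rw [iIndepFun_iff_map_fun_eq_infinitePi_map hf, Measure.map_map (measurable_pi_lambda _ hf) hφ]
  simp only [Measure.map_map (hf _) hφ]
  exact h.map_fun_eq_infinitePi_map fun i => (hf i).comp hφ

theorem count_superpose (A : Set X) (p : Config X × Config X) :
    count A (superpose p) = count A p.1 + count A p.2 := rfl

theorem measurable_superpose : Measurable (superpose (X := X)) :=
  .subtype_mk <| Measure.measurable_of_measurable_coe _ fun _ hA =>
    ((measurable_count hA).comp measurable_fst).add ((measurable_count hA).comp measurable_snd)

theorem IsPoissonLaw.superpose {μ₁ μ₂ : Measure X} {P₁ P₂ : Measure (Config X)}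
    (h₁ : IsPoissonLaw μ₁ P₁) (h₂ : IsPoissonLaw μ₂ P₂) :
    IsPoissonLaw (μ₁ + μ₂) ((P₁.prod P₂).map superpose) := by
  have := h₁.isProbabilityMeasure
  have := h₂.isProbabilityMeasure
  have hlt₁ {A : Set X} (hA : (μ₁ + μ₂) A < ∞) : μ₁ A < ∞ :=
    (Measure.le_add_right le_rfl A).trans_lt hA
  have hlt₂ {A : Set X} (hA : (μ₁ + μ₂) A < ∞) : μ₂ A < ∞ :=
    (Measure.le_add_left le_rfl A).trans_lt hA
  refine ⟨Measure.isProbabilityMeasure_map measurable_superpose.aemeasurable,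
    fun A hA hμ => ?_, fun k A hA hd hμ => ?_⟩
  · have hN := measurable_count hA
    have hlaw₁ := (HasLaw.mk hN.aemeasurable (h₁.law A hA (hlt₁ hμ))).comp
      (measurePreserving_fst (μ := P₁) (ν := P₂)).hasLaw
    have hlaw₂ := (HasLaw.mk hN.aemeasurable (h₂.law A hA (hlt₂ hμ))).comp
      (measurePreserving_snd (μ := P₁) (ν := P₂)).hasLaw
    have hadd := (indepFun_prod hN hN).hasLaw_add_map_cast_poissonMeasure hlaw₁ hlaw₂
    rw [Measure.map_map hN measurable_superpose, Measure.add_apply,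
      ENNReal.toNNReal_add (hlt₁ hμ).ne (hlt₂ hμ).ne]
    exact hadd.map_eq
  · have hN (i : Fin k) := measurable_count (hA i)
    have hpair := iIndepFun_prodMk_prod hN hN (h₁.indep k A hA hd fun i => hlt₁ (hμ i))
      (h₂.indep k A hA hd fun i => hlt₂ (hμ i))
    exact iIndepFun_map measurable_superpose hN <|
      hpair.comp (fun _ c => c.1 + c.2) fun _ => measurable_fst.add measurable_snd

theorem measurePreserving_superpose_poissonLaw {μ₁ μ₂ μ : Measure X} [SigmaFinite μ₁]
    [SigmaFinite μ₂] [SigmaFinite μ] (h : μ₁ + μ₂ = μ) :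
    MeasurePreserving superpose ((poissonLaw μ₁).prod (poissonLaw μ₂)) (poissonLaw μ) := by
  subst h
  exact ⟨measurable_superpose, ((isPoissonLaw_poissonLaw μ₁).superpose
    (isPoissonLaw_poissonLaw μ₂)).unique (isPoissonLaw_poissonLaw _)⟩

theorem IsPoissonLaw.measure_count_eq_zero {μ : Measure X} {P : Measure (Config X)}
    (h : IsPoissonLaw μ P) {A : Set X} (hA : MeasurableSet A) (hμ : μ A < ∞) :
    P {ν | count A ν = 0} = ENNReal.ofReal (Real.exp (-μ.real A)) := by
  have hcast : (fun n : ℕ => (n : ℝ≥0∞)) ⁻¹' {0} = {0} := by ext; simp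
  calc P {ν | count A ν = 0}
    _ = P.map (count A) {0} := (Measure.map_apply (measurable_count hA) (.singleton 0)).symm
    _ = poissonMeasure (μ A).toNNReal {0} := by
        rw [h.law A hA hμ, Measure.map_apply .of_discrete (.singleton 0), hcast]
    _ = ENNReal.ofReal (Real.exp (-μ.real A)) := by
        simp [poissonMeasure_singleton, Measure.real, ENNReal.toReal]

theorem measurableSet_count_eq_zero {A : Set X} (hA : MeasurableSet A) :
    MeasurableSet {ν : Config X | count A ν = 0} :=
  measurable_count hA (.singleton 0)

theorem IsPoissonLaw.measure_count_eq_zero_ne_zero {μ : Measure X} {P : Measure (Config X)}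
    (h : IsPoissonLaw μ P) {A : Set X} (hA : MeasurableSet A) (hμ : μ A < ∞) :
    P {ν | count A ν = 0} ≠ 0 := by
  rw [h.measure_count_eq_zero hA hμ]
  exact (ENNReal.ofReal_pos.2 (Real.exp_pos _)).ne'

theorem IsPoissonLaw.measure_count_ne_zero_ne_zero {μ : Measure X} {P : Measure (Config X)}
    (h : IsPoissonLaw μ P) {A : Set X} (hA : MeasurableSet A) (h0 : μ A ≠ 0) (hμ : μ A < ∞) :
    P {ν | count A ν = 0}ᶜ ≠ 0 := by
  have := h.isProbabilityMeasure
  rw [Ne, prob_compl_eq_zero_iff (measurableSet_count_eq_zero hA), h.measure_count_eq_zero hA hμ,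
    ENNReal.ofReal_eq_one, Real.exp_eq_one_iff, neg_eq_zero]
  exact (measureReal_ne_zero_iff hμ.ne).2 h0

theorem superpose_comp_swap : superpose ∘ Prod.swap = superpose (X := X) :=
  funext fun p => Subtype.ext (add_comm p.2.1 p.1.1)

theorem measurable_superpose_symmAlgebra : Measurable[symmAlgebra X] (superpose (X := X)) :=
  fun _ hs => ⟨measurable_superpose hs, by rw [← Set.preimage_comp, superpose_comp_swap]⟩

theorem measurable_suspend (T : X ≃ᵐ X) : Measurable (suspend T) :=
  ((Measure.measurable_map _ T.measurable).comp measurable_subtype_coe).subtype_mk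

theorem suspend_symm_suspend (T : X ≃ᵐ X) (ν : Config X) : suspend T.symm (suspend T ν) = ν :=
  Subtype.ext T.map_symm_map

theorem comap_suspend (T : X ≃ᵐ X) :
    MeasurableSpace.comap (suspend T) inferInstance =
      (inferInstance : MeasurableSpace (Config X)) := by
  refine le_antisymm (measurable_suspend T).comap_le fun s hs =>
    ⟨suspend T.symm ⁻¹' s, measurable_suspend T.symm hs, ?_⟩
  ext ν
  rw [Set.mem_preimage, Set.mem_preimage, suspend_symm_suspend]

theorem superpose_comp_suspendProd (T : X ≃ᵐ X) :
    superpose ∘ suspendProd T = suspend T ∘ superpose :=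
  funext fun p => Subtype.ext (Measure.map_add p.1.1 p.2.1 T.measurable).symm

theorem isFactor_superposeAlgebra (T : X ≃ᵐ X) :
    IsFactor (symmAlgebra X) (suspendProd T) (superposeAlgebra X) := by
  refine ⟨measurable_superpose_symmAlgebra.comap_le, ?_⟩
  rw [MeasurableSpace.comap_comp, superpose_comp_suspendProd, ← MeasurableSpace.comap_comp,
    comap_suspend]

theorem symmLaw_preimage_superpose (μ : Measure X) [SigmaFinite μ] {s : Set (Config X)}
    (hs : MeasurableSet s) :
    symmLaw μ (superpose ⁻¹' s) = poissonLaw ((2 : ℝ≥0) • μ) s := by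
  rw [symmLaw, trim_measurableSet_eq _ (measurable_superpose_symmAlgebra hs),
    (measurePreserving_superpose_poissonLaw (two_smul ℝ≥0 μ).symm).measure_preimage
      hs.nullMeasurableSet]

theorem isFactorMap_superpose (μ : Measure X) [SigmaFinite μ] (T : X ≃ᵐ X) :
    IsFactorMap (symmAlgebra X) (symmLaw μ) (suspendProd T)
      inferInstance (poissonLaw ((2 : ℝ≥0) • μ)) (suspend T) superpose := by
  have hΨ := measurable_superpose_symmAlgebra (X := X)
  refine ⟨@MeasurePreserving.mk _ _ (symmAlgebra X) _ _ _ _ hΨ <| Measure.ext fun s hs => ?_,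
    superpose_comp_suspendProd T⟩
  rw [@Measure.map_apply _ _ (symmAlgebra X) _ _ _ hΨ _ hs, symmLaw_preimage_superpose μ hs]

theorem not_isTrivial_superposeAlgebra {μ : Measure X} [SigmaFinite μ] {A : Set X}
    (hA : MeasurableSet A) (h0 : μ A ≠ 0) (hμ : μ A < ∞) :
    ¬ IsTrivial (superposeAlgebra X) (symmAlgebra X) (symmLaw μ) := by
  intro h
  have hE := measurableSet_count_eq_zero hA
  have hP := isPoissonLaw_poissonLaw ((2 : ℝ≥0) • μ)
  have h2μ : ((2 : ℝ≥0) • μ) A = 2 * μ A := rfl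
  have h2μ_lt : ((2 : ℝ≥0) • μ) A < ∞ := by rw [h2μ]; finiteness
  rcases h _ ⟨_, hE, rfl⟩ with hnull | hconull
  · rw [symmLaw_preimage_superpose μ hE] at hnull
    exact hP.measure_count_eq_zero_ne_zero hA h2μ_lt hnull
  · rw [← Set.preimage_compl, symmLaw_preimage_superpose μ hE.compl] at hconull
    exact hP.measure_count_ne_zero_ne_zero hA (by simp [h2μ, h0]) h2μ_lt hconull

theorem IsFull.preimage_ae_eq_of_comp_eq {Ω Y Z : Type*} [MeasurableSpace Ω]
    {𝒜 m₀ : MeasurableSpace Y} {ℬ : MeasurableSpace Z} {P : Measure[m₀] Y} {R : Measure Ω}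
    {φ : Y → Z} {h𝒜 : 𝒜 ≤ m₀} (h : IsFull (ℬ.comap φ) 𝒜 (P.trim h𝒜)) {F G : Ω → Y}
    (hF : Measure.QuasiMeasurePreserving F R P) (hG : Measure.QuasiMeasurePreserving G R P)
    (hFG : φ ∘ F = φ ∘ G) {D : Set Y} (hD : MeasurableSet[𝒜] D) :
    F ⁻¹' D =ᵐ[R] G ⁻¹' D := by
  obtain ⟨_, ⟨B, -, rfl⟩, hDB⟩ := h D hD
  have hD_ae : D =ᵐ[P] φ ⁻¹' B := ae_eq_of_ae_eq_trim hDB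
  have hpre : F ⁻¹' (φ ⁻¹' B) = G ⁻¹' (φ ⁻¹' B) := congrArg (· ⁻¹' B) hFG
  exact (hF.preimage_ae_eq hD_ae).trans (hpre ▸ (hG.preimage_ae_eq hD_ae).symm)

theorem measurePreserving_exchange_snd {α β γ δ : Type*} [MeasurableSpace α] [MeasurableSpace β]
    [MeasurableSpace γ] [MeasurableSpace δ] (μ : Measure α) (ν : Measure β) (ρ : Measure γ)
    (τ : Measure δ) [SFinite μ] [SFinite ν] [SFinite ρ] [SFinite τ] :
    MeasurePreserving (fun q : (α × β) × (γ × δ) => ((q.1.1, q.2.2), (q.2.1, q.1.2)))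
      ((μ.prod ν).prod (ρ.prod τ)) ((μ.prod τ).prod (ρ.prod ν)) := by
  have hrotate : MeasurePreserving (fun q : β × (γ × δ) => (q.2.2, (q.2.1, q.1)))
      (ν.prod (ρ.prod τ)) (τ.prod (ρ.prod ν)) :=
    (measurePreserving_prodAssoc τ ρ ν).comp <|
      (Measure.measurePreserving_swap.prod (.id ν)).comp Measure.measurePreserving_swap
  exact ((measurePreserving_prodAssoc μ τ (ρ.prod ν)).symm _).comp <|
    ((MeasurePreserving.id μ).prod hrotate).comp (measurePreserving_prodAssoc μ ν (ρ.prod τ))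

theorem measurableSet_count_eq_zero_or {A : Set X} (hA : MeasurableSet A) :
    MeasurableSet[symmAlgebra X]
      {p : Config X × Config X | count A p.1 = 0 ∨ count A p.2 = 0} :=
  ⟨(measurable_fst (measurableSet_count_eq_zero hA)).union
    (measurable_snd (measurableSet_count_eq_zero hA)), Set.ext fun _ => or_comm⟩

theorem count_superpose_eq_zero {A : Set X} {p : Config X × Config X} :
    count A (superpose p) = 0 ↔ count A p.1 = 0 ∧ count A p.2 = 0 := by
  rw [count_superpose, add_eq_zero]

theorem superpose_exchange_snd (q : (Config X × Config X) × (Config X × Config X)) :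
    superpose (superpose (q.1.1, q.2.2), superpose (q.2.1, q.1.2)) =
      superpose (superpose q.1, superpose q.2) := Subtype.ext <| by
  change q.1.1.1 + q.2.2.1 + (q.2.1.1 + q.1.2.1) = q.1.1.1 + q.1.2.1 + (q.2.1.1 + q.2.2.1)
  abel

theorem preimage_exchange_ae_eq_of_isFull {μ ρ : Measure X} [SigmaFinite μ] [SigmaFinite ρ]
    (hρ : ρ + ρ = μ) (h : IsFull (superposeAlgebra X) (symmAlgebra X) (symmLaw μ))
    {D : Set (Config X × Config X)} (hD : MeasurableSet[symmAlgebra X] D) :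
    (fun q : (Config X × Config X) × (Config X × Config X) =>
        (superpose q.1, superpose q.2)) ⁻¹' D
      =ᵐ[((poissonLaw ρ).prod (poissonLaw ρ)).prod ((poissonLaw ρ).prod (poissonLaw ρ))]
    (fun q => (superpose (q.1.1, q.2.2), superpose (q.2.1, q.1.2))) ⁻¹' D := by
  have hsuperpose := measurePreserving_superpose_poissonLaw hρ
  have hF := hsuperpose.prod hsuperpose
  have hexchange := measurePreserving_exchange_snd
    (poissonLaw ρ) (poissonLaw ρ) (poissonLaw ρ) (poissonLaw ρ)
  exact h.preimage_ae_eq_of_comp_eq hF.quasiMeasurePreserving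
    (hF.comp hexchange).quasiMeasurePreserving
    (funext fun q => (superpose_exchange_snd q).symm) hD

theorem not_isFull_superposeAlgebra {μ : Measure X} [SigmaFinite μ] {A : Set X}
    (hA : MeasurableSet A) (h0 : μ A ≠ 0) (hμ : μ A < ∞) :
    ¬ IsFull (superposeAlgebra X) (symmAlgebra X) (symmLaw μ) := by
  intro h
  let half : Measure X := (2⁻¹ : ℝ≥0) • μ
  have hhalf : half + half = μ := by
    rw [← add_smul, ← two_mul, mul_inv_cancel₀ two_ne_zero, one_smul]
  let Q := poissonLaw half
  let E : Set (Config X) := {ν | count A ν = 0}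
  have hae := preimage_exchange_ae_eq_of_isFull hhalf h (measurableSet_count_eq_zero_or hA)
  have hnull : ((Q.prod Q).prod (Q.prod Q)) ((Eᶜ ×ˢ Eᶜ) ×ˢ (E ×ˢ E)) = 0 := by
    refine measure_mono_null ?_ (ae_eq_set.1 hae).1
    rintro q ⟨⟨h₁, h₂⟩, h₃, h₄⟩
    refine ⟨.inr (count_superpose_eq_zero.2 ⟨h₃, h₄⟩), ?_⟩
    rintro (h₁₄ | h₃₂)
    · exact h₁ (count_superpose_eq_zero.1 h₁₄).1
    · exact h₂ (count_superpose_eq_zero.1 h₃₂).2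
  have hhalf0 : half A ≠ 0 := by simp [half, h0]
  have hhalf_lt : half A < ∞ := (Measure.le_add_right le_rfl A).trans_lt (hhalf ▸ hμ)
  have hQ := isPoissonLaw_poissonLaw half
  have hE : Q E ≠ 0 := hQ.measure_count_eq_zero_ne_zero hA hhalf_lt
  have hEc : Q Eᶜ ≠ 0 := hQ.measure_count_ne_zero_ne_zero hA hhalf0 hhalf_lt
  rw [Measure.prod_prod, Measure.prod_prod, Measure.prod_prod] at hnull
  exact mul_ne_zero (mul_ne_zero hEc hEc) (mul_ne_zero hE hE) hnull

theorem exists_measurableSet_measure_ne_zero_lt_top {μ : Measure X} [SigmaFinite μ] (hμ : μ ≠ 0) :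
    ∃ A, MeasurableSet A ∧ μ A ≠ 0 ∧ μ A < ∞ := by
  obtain ⟨A, hA, -, hpos, hlt⟩ :=
    Measure.exists_subset_measure_lt_top .univ (Measure.measure_univ_pos.2 hμ)
  exact ⟨A, hA, hpos.ne', hlt⟩

end PoissonSuspension

theorem proposition4p4_general {X : Type*} [MeasurableSpace X] (μ : Measure X) [SigmaFinite μ]
    (hμ : μ ≠ 0) (T : X ≃ᵐ X) :
    ¬ IsPrime (symmAlgebra X) (symmLaw μ) (suspendProd T) ∧
    IsFactorMap (symmAlgebra X) (symmLaw μ) (suspendProd T)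
      inferInstance (poissonLaw ((2 : ℝ≥0) • μ)) (suspend T) superpose ∧
    IsFactor (symmAlgebra X) (suspendProd T) (superposeAlgebra X) ∧
    ¬ IsFull (superposeAlgebra X) (symmAlgebra X) (symmLaw μ) ∧
    ¬ IsTrivial (superposeAlgebra X) (symmAlgebra X) (symmLaw μ) := by
  obtain ⟨A, hA, h0, hlt⟩ := exists_measurableSet_measure_ne_zero_lt_top hμ
  have hfactor := isFactor_superposeAlgebra T
  have hfull := not_isFull_superposeAlgebra hA h0 hlt
  have htrivial := not_isTrivial_superposeAlgebra hA h0 hlt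
  exact ⟨fun hprime => (hprime _ hfactor).elim hfull htrivial,
    isFactorMap_superpose μ T, hfactor, hfull, htrivial⟩

theorem proposition4p4 {X : Type*} [MeasurableSpace X] (μ : Measure X) [SigmaFinite μ]
    (hinf : μ Set.univ = ∞) (hcont : ∀ x : X, μ {x} = 0)
    (T : X ≃ᵐ X) (hT : MeasurePreserving T μ μ) :
    -- the symmetric factor of the direct product of two copies of the suspension is not prime
    ¬ IsPrime (symmAlgebra X) (symmLaw μ) (suspendProd T) ∧
    -- superposition is a factor map from it onto the suspension with intensity `2 μ`
    IsFactorMap (symmAlgebra X) (symmLaw μ) (suspendProd T)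
      inferInstance (poissonLaw ((2 : ℝ≥0) • μ)) (suspend T) superpose ∧
    -- the corresponding sub-σ-algebra is a factor, it is strict, and it is non-trivial
    IsFactor (symmAlgebra X) (suspendProd T) (superposeAlgebra X) ∧
    ¬ IsFull (superposeAlgebra X) (symmAlgebra X) (symmLaw μ) ∧
    ¬ IsTrivial (superposeAlgebra X) (symmAlgebra X) (symmLaw μ) :=
  proposition4p4_general μ (by rintro rfl; simp at hinf) T
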